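/- Let $k$ be a countable (finite or countably infinite) field and let $A$ be a nonzero associative unital $k$-algebra that is countably generated, i.e. generated as a unital $k$-algebra by a finite or countably infinite subset. Then $A$ embeds into a simple two-generated associative algebra: there exist an associative unital $k$-algebra $B$, elements $a,b\in B$ and an injective homomorphism of unital $k$-algebras $\varphi\colon A\to B$ such that $B$ is simple (i.e. $B\neq 0$ and the only two-sided ideals of $B$ are $0$ and $B$) and $B$ is generated as a unital $k$-algebra by $a$ and $b$. -/

import Mathlib

universe u v

/-!
Let `W = ℕ →₀ A`, on which `A` acts by multiplication. Both `k` and `A` are countable, so `W` has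
a countable basis. A nonzero `a : A` acts on `W` with infinite rank; hence there are `k`-linear
endomorphisms `u`, `v` of `W` with `u ∘ a ∘ v = 1`
(`exists_comp_mulLeft_comp_eq_one`).

Since `W` is isomorphic to a countable direct sum of copies of itself, every countable family of
endomorphisms of `W` lies in a subalgebra generated by two elements
(`exists_adjoin_pair_of_countable`, the linear form of the theorem of Sierpiński and Banach on
countable sets of self-maps). Apply this to the operators of `A` together with the chosen `u` and
`v`, for all nonzero `a`. The resulting two-generated algebra `C` contains `A`, and every nonzero
element of `A` generates the unit ideal of `C`. So a maximal two-sided ideal `M` of `C`, which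
exists by Zorn's lemma, meets `A` trivially, and `A` embeds into the simple two-generated
algebra `C ⧸ M`.
-/

/-! ### Countability -/

theorem Algebra.countable_adjoin {k : Type*} {R : Type*} [Field k] [Countable k] [Ring R]
    [Algebra k R] {s : Set R} (hs : s.Countable) : Countable (Algebra.adjoin k s) := by
  have := hs.to_subtype
  have hF : Countable (FreeAlgebra k s) := by
    rw [← Cardinal.mk_le_aleph0_iff]
    refine (FreeAlgebra.cardinalMk_le_max_lift k s).trans ?_
    simp
  rw [Algebra.adjoin_eq_range_freeAlgebra_lift]
  exact (AlgHom.rangeRestrict_surjective _).countable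

/-! ### Two-generated algebras of endomorphisms -/

/-- A countable family of endomorphisms of `ℕ →₀ M` lies in a two-generated subalgebra. With
`ι n` the inclusions of the summands in a decomposition of `ℕ →₀ M` into countably many copies of
itself, take `c ∘ ι n = ι (n + 1)`, `b ∘ ι (n + 1) = ι 0 ∘ ι n` and `b ∘ ι 0 = d`, where
`d ∘ ι n = f n`. Then `b * c = ι 0` and `b * b * c = d`, so that
`f n = d * c ^ n * ι 0` is a word in `b` and `c`. -/
theorem exists_adjoin_pair_of_nat {k M : Type*} [Field k] [AddCommGroup M] [Module k M]
    (f : ℕ → Module.End k (ℕ →₀ M)) :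
    ∃ b c : Module.End k (ℕ →₀ M), ∀ n, f n ∈ Algebra.adjoin k {b, c} := by
  let e : (ℕ →₀ (ℕ →₀ M)) ≃ₗ[k] (ℕ →₀ M) :=
    (Finsupp.curryLinearEquiv k).symm ≪≫ₗ Finsupp.domLCongr Nat.pairEquiv
  let ι : ℕ → Module.End k (ℕ →₀ M) := fun n ↦ e.toLinearMap ∘ₗ Finsupp.lsingle n
  let copair : (ℕ → Module.End k (ℕ →₀ M)) → Module.End k (ℕ →₀ M) :=
    fun g ↦ Finsupp.lsum k g ∘ₗ e.symm.toLinearMap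
  have copair_ι (g : ℕ → Module.End k (ℕ →₀ M)) (n : ℕ) : copair g * ι n = g n := by
    refine LinearMap.ext fun x ↦ ?_
    simp [copair, ι]
  have hom_ext {g h : Module.End k (ℕ →₀ M)} (H : ∀ n, g * ι n = h * ι n) : g = h := by
    have : g ∘ₗ e.toLinearMap = h ∘ₗ e.toLinearMap := Finsupp.lhom_ext' H
    refine LinearMap.ext fun x ↦ ?_
    simpa using LinearMap.congr_fun this (e.symm x)
  let c := copair fun n ↦ ι (n + 1)
  let d := copair f
  let b := copair fun n ↦ Nat.casesOn n d fun m ↦ ι 0 * ι m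
  have hc (n) : c * ι n = ι (n + 1) := copair_ι _ n
  have hb0 : b * ι 0 = d := copair_ι _ 0
  have hbs (n) : b * ι (n + 1) = ι 0 * ι n := copair_ι _ (n + 1)
  have hbc : b * c = ι 0 := hom_ext fun n ↦ by rw [mul_assoc, hc, hbs]
  have hcn (n) : c ^ n * ι 0 = ι n := by
    induction n with
    | zero => simp
    | succ n ih => rw [pow_succ', mul_assoc, ih, hc]
  refine ⟨b, c, fun n ↦ ?_⟩
  have hb : b ∈ Algebra.adjoin k {b, c} := Algebra.subset_adjoin (by simp)
  have hc' : c ∈ Algebra.adjoin k {b, c} := Algebra.subset_adjoin (by simp)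
  have hf : f n = b * (b * c) * (c ^ n * (b * c)) := by
    rw [hbc, hcn, hb0]
    exact (copair_ι f n).symm
  rw [hf]
  exact mul_mem (mul_mem hb (mul_mem hb hc')) (mul_mem (pow_mem hc' n) (mul_mem hb hc'))

theorem exists_adjoin_pair_of_countable {k M : Type*} [Field k] [AddCommGroup M] [Module k M]
    {s : Set (Module.End k (ℕ →₀ M))} (hs : s.Countable) :
    ∃ b c : Module.End k (ℕ →₀ M), s ⊆ Algebra.adjoin k {b, c} := by
  obtain ⟨f, hf⟩ := Set.countable_iff_exists_subset_range.mp hs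
  obtain ⟨b, c, h⟩ := exists_adjoin_pair_of_nat f
  refine ⟨b, c, fun x hx ↦ ?_⟩
  obtain ⟨n, rfl⟩ := hf hx
  exact h n

/-- A nonzero element of a countable algebra `A` acts with infinite rank on `ℕ →₀ A`, and hence
becomes the identity after multiplication by suitable endomorphisms on both sides. -/
theorem exists_comp_mulLeft_comp_eq_one {k A : Type*} [Field k] [Ring A] [Algebra k A]
    [Countable A] {a : A} (ha : a ≠ 0) :
    ∃ u v : Module.End k (ℕ →₀ A), u * Algebra.lsmul k k (ℕ →₀ A) a * v = 1 := by
  let B := Module.Basis.ofVectorSpace k (ℕ →₀ A)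
  obtain ⟨j, hj⟩ := exists_injective_nat (Module.Basis.ofVectorSpaceIndex k (ℕ →₀ A))
  -- The countable basis goes to distinct vectors `single n 1`, and `a` sends these to the
  -- independent vectors `single n a`.
  let v : Module.End k (ℕ →₀ A) := B.constr k fun i ↦ Finsupp.single (j i) (1 : A)
  let w : (ℕ →₀ A) →ₗ[k] (ℕ →₀ A) := (Algebra.lsmul k k (ℕ →₀ A) a : Module.End k (ℕ →₀ A)) * v
  have hw : (⇑w ∘ ⇑B) = (fun n ↦ Finsupp.single n a) ∘ j := by
    ext1 i
    simp [w, v, Module.Basis.constr_basis]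
  have hli : LinearIndependent k (⇑w ∘ ⇑B) := by
    rw [hw]
    refine LinearIndependent.comp ?_ j hj
    exact Finsupp.linearIndependent_single_of_ne_zero fun _ ↦ ha
  have hker : LinearMap.ker w = ⊥ := LinearMap.ker_eq_bot.mpr <| by
    rw [← B.constr_self k w]
    exact B.injective_constr_of_linearIndependent hli
  obtain ⟨u, hu⟩ := w.exists_leftInverse_of_injective hker
  exact ⟨u, v, by rw [mul_assoc]; exact hu⟩

/-! ### Simple quotients -/

/-- Every nonzero ring has a simple quotient, by a maximal two-sided ideal. -/
theorem Ideal.exists_isTwoSided_isSimpleRing_quotient (C : Type*) [Ring C] [Nontrivial C] :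
    ∃ (M : Ideal C) (_ : M.IsTwoSided), IsSimpleRing (C ⧸ M) := by
  obtain ⟨M, -, hM⟩ := zorn_le_nonempty₀ {I : Ideal C | I.IsTwoSided ∧ I ≠ ⊤}
    (fun c hc hch y hy ↦ by
      have hmem {x : C} : x ∈ sSup c ↔ ∃ I ∈ c, x ∈ I :=
        Submodule.mem_sSup_of_directed ⟨y, hy⟩ hch.directedOn
      refine ⟨sSup c, ⟨⟨fun {x} z hx ↦ ?_⟩, ?_⟩, fun I hI ↦ le_sSup hI⟩
      · obtain ⟨I, hI, hxI⟩ := hmem.mp hx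
        have := (hc hI).1
        exact hmem.mpr ⟨I, hI, I.mul_mem_right z hxI⟩
      · rw [Ne, Ideal.eq_top_iff_one]
        intro h1
        obtain ⟨I, hI, h1I⟩ := hmem.mp h1
        exact (hc hI).2 ((Ideal.eq_top_iff_one I).mpr h1I))
    ⊥ ⟨inferInstance, bot_ne_top⟩
  have := hM.prop.1
  have : Nontrivial (C ⧸ M) := Ideal.Quotient.nontrivial_iff.mpr hM.prop.2
  refine ⟨M, hM.prop.1, isSimpleRing_iff_isTwoSided_imp.mpr ⟨this, fun J hJ ↦ ?_⟩⟩
  by_cases hJ' : J = ⊤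
  · exact Or.inr hJ'
  left
  have hle : M ≤ J.comap (Ideal.Quotient.mk M) := fun x hx ↦ by
    rw [Ideal.mem_comap, Ideal.Quotient.eq_zero_iff_mem.mpr hx]
    exact J.zero_mem
  have hge : J.comap (Ideal.Quotient.mk M) ≤ M :=
    hM.le_of_ge ⟨inferInstance, Ideal.comap_ne_top _ hJ'⟩ hle
  rw [eq_bot_iff]
  intro x hx
  obtain ⟨x, rfl⟩ := Ideal.Quotient.mk_surjective x
  exact Ideal.Quotient.eq_zero_iff_mem.mpr (hge hx)

/-- If every nonzero element of the image of `A` generates the unit ideal of a countable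
two-generated algebra `C`, then `A` embeds into a simple quotient of `C`. By countability this
quotient has a model in any universe. -/
theorem exists_isSimpleRing_adjoin_pair_injective {k A : Type*} {C : Type v} [Field k] [Ring A]
    [Algebra k A] [Ring C] [Algebra k C] [Nontrivial C] [Countable C] {b c : C}
    (hbc : Algebra.adjoin k {b, c} = ⊤) (L : A →ₐ[k] C)
    (hL : ∀ a ≠ 0, ∃ u v : C, u * L a * v = 1) :
    ∃ (B : Type u) (_ : Ring B) (_ : Algebra k B),
      IsSimpleRing B ∧
      (∃ a b : B, Algebra.adjoin k {a, b} = ⊤) ∧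
      ∃ φ : A →ₐ[k] B, Function.Injective φ := by
  obtain ⟨M, hM, hsimple⟩ := Ideal.exists_isTwoSided_isSimpleRing_quotient C
  have : Countable (C ⧸ M) := Ideal.Quotient.mk_surjective.countable
  let e : (C ⧸ M) ≃ₐ[k] Shrink.{u} (C ⧸ M) := (Shrink.algEquiv.{u} k (C ⧸ M)).symm
  let ψ : C →ₐ[k] Shrink.{u} (C ⧸ M) := (e : _ →ₐ[k] _).comp (Ideal.Quotient.mkₐ k M)
  have hψ : Function.Surjective ψ := e.surjective.comp Ideal.Quotient.mk_surjective
  refine ⟨Shrink.{u} (C ⧸ M), inferInstance, inferInstance,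
    IsSimpleRing.of_ringEquiv e.toRingEquiv hsimple, ⟨ψ b, ψ c, ?_⟩, ψ.comp L, ?_⟩
  · rw [← Set.image_pair, ← AlgHom.map_adjoin, hbc, Algebra.map_top]
    exact (AlgHom.range_eq_top ψ).mpr hψ
  · rw [injective_iff_map_eq_zero]
    intro a ha
    by_contra hne
    obtain ⟨u, v, huv⟩ := hL a hne
    have hmem : L a ∈ M :=
      Ideal.Quotient.eq_zero_iff_mem.mp ((map_eq_zero_iff e e.injective).mp ha)
    have h1 : (1 : C) ∈ M := by
      rw [← huv]
      exact M.mul_mem_right _ (M.mul_mem_left _ hmem)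
    have : Nontrivial (C ⧸ M) := inferInstance
    exact Ideal.Quotient.nontrivial_iff.mp this ((Ideal.eq_top_iff_one M).mpr h1)

/-! ### The embedding -/

theorem mainTheorem1 {k : Type u} [Field k] [Countable k]
    {A : Type v} [Ring A] [Algebra k A] [Nontrivial A]
    (hA : ∃ s : Set A, s.Countable ∧ Algebra.adjoin k s = ⊤) :
    ∃ (B : Type u) (_ : Ring B) (_ : Algebra k B),
      IsSimpleRing B ∧
      (∃ a b : B, Algebra.adjoin k {a, b} = ⊤) ∧
      ∃ φ : A →ₐ[k] B, Function.Injective φ := by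
  obtain ⟨s, hs, hsA⟩ := hA
  have : Countable A := by
    have := Algebra.countable_adjoin (k := k) hs
    rw [hsA] at this
    exact (Subalgebra.topEquiv (R := k) (A := A)).symm.injective.countable
  let L : A →ₐ[k] Module.End k (ℕ →₀ A) := Algebra.lsmul k k (ℕ →₀ A)
  choose! p q hpq using fun (a : A) (ha : a ≠ 0) ↦
    exists_comp_mulLeft_comp_eq_one (k := k) ha
  obtain ⟨b, c, hbc⟩ := exists_adjoin_pair_of_countable
    (((Set.countable_range L).union (Set.countable_range p)).union (Set.countable_range q))
  let C := Algebra.adjoin k {b, c}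
  have hL (a : A) : L a ∈ C := hbc (Or.inl (Or.inl ⟨a, rfl⟩))
  have hp (a : A) : p a ∈ C := hbc (Or.inl (Or.inr ⟨a, rfl⟩))
  have hq (a : A) : q a ∈ C := hbc (Or.inr ⟨a, rfl⟩)
  have : Countable C := Algebra.countable_adjoin (Set.toFinite _).countable
  let b' : C := ⟨b, Algebra.subset_adjoin (by simp)⟩
  let c' : C := ⟨c, Algebra.subset_adjoin (by simp)⟩
  have hgen : Algebra.adjoin k {b', c'} = ⊤ := by
    have h := Algebra.adjoin_adjoin_coe_preimage (R := k) (s := {b, c})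
    rw [← h]
    congr 1
    ext x
    simp [b', c', Subtype.ext_iff]
  exact exists_isSimpleRing_adjoin_pair_injective hgen (L.codRestrict C hL)
    fun a ha ↦ ⟨⟨p a, hp a⟩, ⟨q a, hq a⟩, Subtype.ext (hpq a ha)⟩
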